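/- Let $(\Omega,\mathcal F,\mu)$ be a complete $\sigma$-finite measure space and let $(H_\omega)_{\omega\in\Omega}$ be a family of real Hilbert spaces. Let $\mathfrak G$ be a vector subspace of $\prod_{\omega\in\Omega}H_\omega$ such that: for every $x\in\mathfrak G$ the function $\omega\mapsto\|x(\omega)\|$ is $\mathcal F$-measurable; every $x\in\prod_{\omega\in\Omega}H_\omega$ for which $\omega\mapsto\langle x(\omega),y(\omega)\rangle$ is $\mathcal F$-measurable for all $y\in\mathfrak G$ lies in $\mathfrak G$; and there is a sequence $(e_n)_{n\in\mathbb N}$ in $\mathfrak G$ such that, for every $\omega\in\Omega$, the closed linear span of $\{e_n(\omega)\}_{n\in\mathbb N}$ is $H_\omega$. Set $\mathfrak H=\{x\in\mathfrak G:\int_\Omega\|x(\omega)\|^2\,\mu(d\omega)<+\infty\}$. For a real Hilbert space $H$, let $\Gamma_0(H)$ be the class of lower semicontinuous convex functions $f\colon H\to\,]-\infty,+\infty]$ that are not identically $+\infty$; for $f\in\Gamma_0(H)$ and $x\in H$, $\operatorname{prox}_f x$ denotes the unique minimizer of $y\mapsto f(y)+\tfrac12\|x-y\|^2$ over $H$.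 Let $G$ be a separable real Hilbert space and, for every $\omega\in\Omega$, let $f_\omega\in\Gamma_0(H_\omega)$ and let $L_\omega\colon G\to H_\omega$ be linear and bounded, with adjoint $L_\omega^*$. Suppose that: (A) for every $x\in\mathfrak H$, the mapping $\omega\mapsto\operatorname{prox}_{f_\omega}(x(\omega))$ lies in $\mathfrak G$; (B) there exists $z\in\mathfrak H$ such that the mapping $\omega\mapsto\operatorname{prox}_{f_\omega}(z(\omega))$ lies in $\mathfrak H$; (C) for every $z\in G$, the mapping $\omega\mapsto L_\omega z$ lies in $\mathfrak G$; (D) $\int_\Omega\|L_\omega\|^2\,\mu(d\omega)\le 1$. Then, for every $z\in G$, the mapping $\omega\mapsto L_\omega^*(\operatorname{prox}_{f_\omega}(L_\omega z))$ is Bochner $\mu$-integrable, and there exists $g\in\Gamma_0(G)$ such that, for every $z\in G$, $$\operatorname{prox}_g z=\int_\Omega L_\omega^*\bigl(\operatorname{prox}_{f_\omega}(L_\omega z)\bigr)\,\mu(d\omega).$$ -/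

import Mathlib

open MeasureTheory TopologicalSpace

/-- The class `Γ₀(H)`: functions `f : H → ]-∞, +∞]` that are proper (finite somewhere),
lower semicontinuous and convex (i.e. with convex epigraph). -/
structure IsGammaZero {H : Type*} [NormedAddCommGroup H] [InnerProductSpace ℝ H]
    (f : H → EReal) : Prop where
  ne_bot : ∀ x, f x ≠ ⊥
  exists_ne_top : ∃ x, f x ≠ ⊤
  lsc : LowerSemicontinuous f
  convex_epigraph : Convex ℝ {p : H × ℝ | f p.1 ≤ (p.2 : EReal)}

/-- `p` minimizes `y ↦ f y + ‖x - y‖² / 2` over `H`. -/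
def IsProxPoint {H : Type*} [NormedAddCommGroup H] [InnerProductSpace ℝ H]
    (f : H → EReal) (x p : H) : Prop :=
  ∀ y : H, f p + ((‖x - p‖ ^ 2 / 2 : ℝ) : EReal) ≤ f y + ((‖x - y‖ ^ 2 / 2 : ℝ) : EReal)

/-- The proximity operator of `f`: it maps `x` to the minimizer of `y ↦ f y + ‖x - y‖² / 2`.
For `f ∈ Γ₀(H)` with `H` a Hilbert space, this minimizer exists and is unique
(`IsGammaZero.existsUnique_isProxPoint`). -/
noncomputable def prox {H : Type*} [NormedAddCommGroup H] [InnerProductSpace ℝ H]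
    (f : H → EReal) (x : H) : H :=
  @Classical.epsilon H ⟨0⟩ (IsProxPoint f x)

/-- `((H ω)_ω, 𝔊)` is a measurable vector field of real Hilbert spaces: `𝔊` is a vector subspace
of the product of the spaces `H ω` whose elements have measurable norm functions, which contains
every `x` whose scalar products with all elements of `𝔊` are measurable, and which contains a
sequence that is total in `H ω` for each `ω`. -/
structure IsMeasurableVectorField {Ω : Type*} [MeasurableSpace Ω] {H : Ω → Type*}
    [∀ ω, NormedAddCommGroup (H ω)] [∀ ω, InnerProductSpace ℝ (H ω)]
    (𝔊 : Submodule ℝ (∀ ω, H ω)) : Prop where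
  measurable_norm : ∀ x ∈ 𝔊, Measurable fun ω => ‖x ω‖
  mem_of_measurable_inner : ∀ x : ∀ ω, H ω,
    (∀ y ∈ 𝔊, Measurable fun ω => inner ℝ (x ω) (y ω)) → x ∈ 𝔊
  exists_total_seq : ∃ e : ℕ → ∀ ω, H ω, (∀ n, e n ∈ 𝔊) ∧
    ∀ ω, (Submodule.span ℝ (Set.range fun n => e n ω)).topologicalClosure = ⊤

/-- The set `𝔥` of square-integrable elements of `𝔊`. -/
def squareIntegrableFields {Ω : Type*} [MeasurableSpace Ω] (μ : Measure Ω) {H : Ω → Type*}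
    [∀ ω, NormedAddCommGroup (H ω)] [∀ ω, InnerProductSpace ℝ (H ω)]
    (𝔊 : Submodule ℝ (∀ ω, H ω)) : Set (∀ ω, H ω) :=
  {x | x ∈ 𝔊 ∧ ∫⁻ ω, ‖x ω‖ₑ ^ 2 ∂μ < ⊤}

/-- Parallelogram identity for the quadratic term at a midpoint. -/
theorem prox_midpoint_identity {H : Type*} [NormedAddCommGroup H] [InnerProductSpace ℝ H]
    (x y z : H) :
    ‖x - ((1 / 2 : ℝ) • y + (1 / 2 : ℝ) • z)‖ ^ 2 / 2 =
      (‖x - y‖ ^ 2 / 2 + ‖x - z‖ ^ 2 / 2) / 2 - ‖y - z‖ ^ 2 / 8 := by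
  have h := parallelogram_law_with_norm ℝ (x - y) (x - z)
  have h1 : x - y + (x - z) = (2 : ℝ) • (x - ((1 / 2 : ℝ) • y + (1 / 2 : ℝ) • z)) := by
    module
  have h2 : x - y - (x - z) = -(y - z) := by abel
  rw [h1, h2, norm_neg, norm_smul, Real.norm_of_nonneg (by norm_num : (0 : ℝ) ≤ 2)] at h
  nlinarith [h]

/-- The proximity operator of a function in `Γ₀(H)` is well defined. -/
theorem IsGammaZero.existsUnique_isProxPoint {H : Type*} [NormedAddCommGroup H]
    [InnerProductSpace ℝ H] [CompleteSpace H] {f : H → EReal} (hf : IsGammaZero f) (x : H) :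
    ∃! p, IsProxPoint f x p := by
  set E : Set (H × ℝ) := {p : H × ℝ | f p.1 ≤ (p.2 : EReal)} with hE
  have hclosed : IsClosed E := by
    have h1 : IsClosed {p : H × EReal | f p.1 ≤ p.2} := hf.lsc.isClosed_epigraph
    exact h1.preimage (continuous_fst.prodMk (continuous_coe_real_ereal.comp continuous_snd))
  have hreal : ∀ y, f y ≠ ⊤ → ((f y).toReal : EReal) = f y := fun y hy =>
    EReal.coe_toReal hy (hf.ne_bot y)
  obtain ⟨x0, hx0⟩ := hf.exists_ne_top
  set t0 := (f x0).toReal with ht0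
  have hft0 : f x0 = (t0 : EReal) := (hreal x0 hx0).symm
  have h0E : (x0, t0) ∈ E := by simp [hE, hft0]
  set s : H × ℝ → ℝ := fun q => q.2 + ‖x - q.1‖ ^ 2 / 2 with hs
  -- linear lower bound on the epigraph
  obtain ⟨r, hr, hball⟩ : ∃ r > 0, ∀ y ∈ Metric.ball x0 r, ((t0 - 1 : ℝ) : EReal) < f y := by
    have := hf.lsc x0 ((t0 - 1 : ℝ) : EReal) (by
      change ((t0 - 1 : ℝ) : EReal) < f x0
      rw [hft0]; exact EReal.coe_lt_coe_iff.2 (by linarith))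
    exact Metric.eventually_nhds_iff_ball.1 this
  have hlow : ∀ q ∈ E, t0 - 1 - 2 * ‖q.1 - x0‖ / r ≤ q.2 := by
    rintro ⟨y, t⟩ hq
    have hnn : 0 ≤ 2 * ‖y - x0‖ / r := by positivity
    by_cases hd : ‖y - x0‖ < r
    · have h1 := hball y (by simpa [dist_eq_norm] using hd)
      have h2 := EReal.coe_lt_coe_iff.1 (h1.trans_le hq)
      simp only
      linarith
    · rw [not_lt] at hd
      have hdp : 0 < ‖y - x0‖ := hr.trans_le hd
      set l := r / (2 * ‖y - x0‖) with hl
      have hl0 : 0 < l := by positivity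
      have hl1 : l ≤ 1 := by
        rw [hl, div_le_one (by positivity)]; linarith
      have hmem := hf.convex_epigraph h0E hq (sub_nonneg.2 hl1) hl0.le (by ring)
      have hb : ((1 - l) • (x0, t0) + l • (y, t)).1 ∈ Metric.ball x0 r := by
        have he : ((1 - l) • (x0, t0) + l • (y, t)).1 - x0 = l • (y - x0) := by
          simp only [Prod.fst_add, Prod.smul_fst]; module
        rw [Metric.mem_ball, dist_eq_norm, he, norm_smul, Real.norm_of_nonneg hl0.le, hl]
        have : r / (2 * ‖y - x0‖) * ‖y - x0‖ = r / 2 := by field_simp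
        rw [this]; linarith
      have h2 := EReal.coe_lt_coe_iff.1 ((hball _ hb).trans_le hmem)
      simp only [Prod.snd_add, Prod.smul_snd, smul_eq_mul] at h2
      have h3 : l * (2 * ‖y - x0‖ / r) = 1 := by rw [hl]; field_simp
      have h4 : l * (t0 - t) < l * (2 * ‖y - x0‖ / r) := by rw [h3]; linarith
      have h5 := lt_of_mul_lt_mul_left h4 hl0.le
      simp only
      linarith
  have hbdd : BddBelow (s '' E) := by
    refine ⟨t0 - 1 - 2 * ‖x - x0‖ / r - 2 / r ^ 2, ?_⟩
    rintro _ ⟨⟨y, t⟩, hq, rfl⟩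
    have h1 := hlow _ hq
    have h2 : ‖y - x0‖ ≤ ‖x - y‖ + ‖x - x0‖ := by
      have := norm_sub_le (x - x0) (x - y)
      rw [show x - x0 - (x - y) = y - x0 by abel] at this
      linarith
    have h3 : 2 * ‖y - x0‖ / r ≤ 2 * ‖x - y‖ / r + 2 * ‖x - x0‖ / r := by
      rw [← add_div]; gcongr; linarith
    have h4 : 0 ≤ (‖x - y‖ - 2 / r) ^ 2 := sq_nonneg _
    have h5 : (‖x - y‖ - 2 / r) ^ 2 = ‖x - y‖ ^ 2 - 2 * (2 * ‖x - y‖ / r) + 2 * (2 / r ^ 2) := by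
      field_simp; ring
    simp only [hs] at h1 ⊢
    linarith
  have hne : (s '' E).Nonempty := ⟨_, _, h0E, rfl⟩
  set m := sInf (s '' E) with hm
  have hmle : ∀ q ∈ E, m ≤ s q := fun q hq => csInf_le hbdd ⟨q, hq, rfl⟩
  have hmid : ∀ q ∈ E, ∀ q' ∈ E, ‖q.1 - q'.1‖ ^ 2 ≤ 4 * (s q + s q' - 2 * m) := by
    rintro ⟨y, t⟩ hq ⟨z, u⟩ hq'
    have h1 := hmle _ (hf.convex_epigraph hq hq' (by norm_num : (0 : ℝ) ≤ 1 / 2)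
      (by norm_num : (0 : ℝ) ≤ 1 / 2) (by norm_num))
    have h2 := prox_midpoint_identity x y z
    simp only [hs, Prod.snd_add, Prod.smul_snd, Prod.fst_add, Prod.smul_fst, smul_eq_mul] at h1 ⊢
    rw [h2] at h1
    linarith
  have hcoe : ∀ y, f y ≠ ⊤ → f y + ((‖x - y‖ ^ 2 / 2 : ℝ) : EReal) =
      ((s (y, (f y).toReal) : ℝ) : EReal) := by
    intro y hy
    simp only [hs]
    rw [EReal.coe_add, hreal y hy]
  have hyE : ∀ y, f y ≠ ⊤ → (y, (f y).toReal) ∈ E := fun y hy => by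
    simp only [hE, Set.mem_ofPred_eq]; exact (hreal y hy).ge
  -- a minimizing sequence
  have hseq : ∀ n : ℕ, ∃ q ∈ E, s q < m + 1 / ((n : ℝ) + 1) := by
    intro n
    obtain ⟨_, ⟨q, hq, rfl⟩, h⟩ := exists_lt_of_csInf_lt hne
      (show sInf (s '' E) < m + 1 / ((n : ℝ) + 1) from lt_add_of_pos_right _ (by positivity))
    exact ⟨q, hq, h⟩
  choose q hqE hqs using hseq
  have hcau : CauchySeq fun n => (q n).1 := by
    have hlim : Filter.Tendsto (fun n : ℕ => Real.sqrt (8 * (1 / ((n : ℝ) + 1))))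
        Filter.atTop (nhds 0) := by
      have := ((tendsto_one_div_add_atTop_nhds_zero_nat (𝕜 := ℝ)).const_mul 8).sqrt
      simpa using this
    refine cauchySeq_of_le_tendsto_0 _ (fun n k N hn hk => ?_) hlim
    have h1 := hmid _ (hqE n) _ (hqE k)
    have h2 : 1 / ((n : ℝ) + 1) ≤ 1 / ((N : ℝ) + 1) := by
      have : (N : ℝ) ≤ n := by exact_mod_cast hn
      gcongr
    have h3 : 1 / ((k : ℝ) + 1) ≤ 1 / ((N : ℝ) + 1) := by
      have : (N : ℝ) ≤ k := by exact_mod_cast hk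
      gcongr
    rw [dist_eq_norm]
    apply Real.le_sqrt_of_sq_le
    have h4 := hqs n
    have h5 := hqs k
    linarith
  obtain ⟨p, hp⟩ := cauchySeq_tendsto_of_complete hcau
  have hslim : Filter.Tendsto (fun n => s (q n)) Filter.atTop (nhds m) := by
    have hup : Filter.Tendsto (fun n : ℕ => m + 1 / ((n : ℝ) + 1)) Filter.atTop (nhds m) := by
      simpa using (tendsto_one_div_add_atTop_nhds_zero_nat (𝕜 := ℝ)).const_add m
    exact tendsto_of_tendsto_of_tendsto_of_le_of_le tendsto_const_nhds hup
      (fun n => hmle _ (hqE n)) (fun n => (hqs n).le)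
  have htlim : Filter.Tendsto (fun n => (q n).2) Filter.atTop (nhds (m - ‖x - p‖ ^ 2 / 2)) := by
    have h1 := hslim.sub (((hp.const_sub x).norm.pow 2).div_const 2)
    refine h1.congr fun n => ?_
    simp only [hs]; ring
  have hpE : (p, m - ‖x - p‖ ^ 2 / 2) ∈ E :=
    hclosed.mem_of_tendsto (hp.prodMk_nhds htlim) (Filter.Eventually.of_forall hqE)
  have hptop : f p ≠ ⊤ := fun h => by
    simp only [hE, Set.mem_ofPred_eq, h] at hpE
    exact absurd hpE (not_le.2 (EReal.coe_lt_top _))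
  refine ⟨p, fun y => ?_, fun p' hp' => ?_⟩
  · by_cases hy : f y = ⊤
    · rw [hy, EReal.top_add_coe]; exact le_top
    · have h1 : f p ≤ ((m - ‖x - p‖ ^ 2 / 2 : ℝ) : EReal) := hpE
      rw [← hreal p hptop] at h1
      have h2 := EReal.coe_le_coe_iff.1 h1
      rw [hcoe p hptop, hcoe y hy]
      refine EReal.coe_le_coe_iff.2 (le_trans ?_ (hmle _ (hyE y hy)))
      simp only [hs]; linarith
  · have h1 := hp' p
    have hp'top : f p' ≠ ⊤ := fun h => by
      rw [h, EReal.top_add_coe, hcoe p hptop] at h1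
      exact absurd h1 (not_le.2 (EReal.coe_lt_top _))
    rw [hcoe p hptop, hcoe p' hp'top] at h1
    have h2 := EReal.coe_le_coe_iff.1 h1
    have h3 : f p ≤ ((m - ‖x - p‖ ^ 2 / 2 : ℝ) : EReal) := hpE
    rw [← hreal p hptop] at h3
    have h4 := EReal.coe_le_coe_iff.1 h3
    have h5 := hmid _ (hyE p' hp'top) _ (hyE p hptop)
    have h6 : s (p, (f p).toReal) ≤ m := by simp only [hs]; linarith
    have h7 : ‖p' - p‖ ^ 2 ≤ 0 := by
      simp only at h5; linarith
    have h8 : ‖p' - p‖ = 0 := by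
      have := sq_nonneg ‖p' - p‖
      exact pow_eq_zero_iff (two_ne_zero) |>.1 (le_antisymm h7 this)
    exact sub_eq_zero.1 (norm_eq_zero.1 h8)

theorem IsGammaZero.prox_eq_iff {H : Type*} [NormedAddCommGroup H]
    [InnerProductSpace ℝ H] [CompleteSpace H] {f : H → EReal} (hf : IsGammaZero f) (x p : H) :
    prox f x = p ↔ IsProxPoint f x p := by
  have hex := hf.existsUnique_isProxPoint x
  have hspec : IsProxPoint f x (prox f x) := Classical.epsilon_spec hex.exists
  exact ⟨fun h => h ▸ hspec, fun h => hex.unique hspec h⟩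

/-! Put `T z = ∫ L_ω^*(prox_{f_ω}(L_ω z))`. For `g` in `Γ₀(G)`, `T z` is the prox point of `z` as
soon as `z - T z` is a subgradient of `g` at `T z`, so it suffices, by Rockafellar's theorem, that
the pairs `(T z, z - T z)` be cyclically monotone.

Along a closed chain `w`, write `Δ` for the increment from index `k` to `k + 1`. The sum of `⟪ΔT, T
w_k⟫` is exactly `-½ Σ ‖ΔT‖²`. The sum of `⟪ΔT, w_k⟫` becomes, through the adjoint, the integral of
`Σ ⟪Δprox, L_ω w_k⟫`. Pointwise this is at most `-½ Σ ‖Δprox‖²`, since the values of `f_ω` in the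
subgradient inequalities telescope. Finally (D) gives `‖ΔT‖² ≤ ∫ ‖Δprox‖²`, which makes the
difference of the two sums nonpositive.

The integrals make sense because prox is nonexpansive: (B) then spreads from one field to all of
`𝔥`. -/

open scoped InnerProductSpace

/-! ### Prox points and subgradients -/

section Prox

variable {E : Type*} [NormedAddCommGroup E] [InnerProductSpace ℝ E]

theorem norm_sub_sq_half_eq (x p y : E) :
    ‖x - y‖ ^ 2 / 2 = ‖x - p‖ ^ 2 / 2 - ⟪y - p, x - p⟫_ℝ + ‖y - p‖ ^ 2 / 2 := by
  have h := norm_sub_sq_real (x - p) (y - p)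
  rw [sub_sub_sub_cancel_right, real_inner_comm] at h
  linarith

/-- A prox point has a finite value. -/
theorem IsProxPoint.ne_top {f : E → EReal} (hf : IsGammaZero f) {x p : E}
    (hp : IsProxPoint f x p) : f p ≠ ⊤ := by
  intro h
  obtain ⟨y, hy⟩ := hf.exists_ne_top
  have h1 := hp y
  rw [h, EReal.top_add_coe, ← EReal.coe_toReal hy (hf.ne_bot y), ← EReal.coe_add] at h1
  exact absurd h1 (not_le.2 (EReal.coe_lt_top _))

/-- If `p` is the prox point of `x`, then `x - p` is a subgradient of `f` at `p`. -/
theorem IsProxPoint.subgradient {f : E → EReal} (hf : IsGammaZero f) {x p : E}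
    (hp : IsProxPoint f x p) (y : E) : f p + (⟪y - p, x - p⟫_ℝ : EReal) ≤ f y := by
  by_cases hy : f y = ⊤
  · rw [hy]; exact le_top
  obtain ⟨a, ha⟩ : ∃ a : ℝ, f p = a :=
    ⟨_, (EReal.coe_toReal (hp.ne_top hf) (hf.ne_bot p)).symm⟩
  obtain ⟨b, hb⟩ : ∃ b : ℝ, f y = b := ⟨_, (EReal.coe_toReal hy (hf.ne_bot y)).symm⟩
  -- Minimality of `p` is tested at `p + t(y - p)`; convexity bounds `f` there, and division by `t`
  -- leaves an error that vanishes as `t → 0`.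
  have key : ∀ t : ℝ, 0 < t → t ≤ 1 → a - b + ⟪y - p, x - p⟫_ℝ ≤ t * (‖y - p‖ ^ 2 / 2) := by
    intro t ht ht1
    have hpE : (p, a) ∈ {q : E × ℝ | f q.1 ≤ (q.2 : EReal)} := ha.le
    have hyE : (y, b) ∈ {q : E × ℝ | f q.1 ≤ (q.2 : EReal)} := hb.le
    have hm : f ((1 - t) • p + t • y) ≤ (((1 - t) * a + t * b : ℝ) : EReal) :=
      hf.convex_epigraph hpE hyE (sub_nonneg.2 ht1) ht.le (by ring)
    have h1 := (hp ((1 - t) • p + t • y)).trans (add_le_add_left hm _)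
    rw [ha, ← EReal.coe_add, ← EReal.coe_add, EReal.coe_le_coe_iff,
      norm_sub_sq_half_eq x p ((1 - t) • p + t • y),
      show (1 - t) • p + t • y - p = t • (y - p) by module, real_inner_smul_left, norm_smul,
      Real.norm_of_nonneg ht.le] at h1
    have h2 : t * (a - b + ⟪y - p, x - p⟫_ℝ) ≤ t * (t * (‖y - p‖ ^ 2 / 2)) := by
      linarith
    exact le_of_mul_le_mul_left h2 ht
  have hlim : a - b + ⟪y - p, x - p⟫_ℝ ≤ 0 := by
    have h1 : Filter.Tendsto (fun t : ℝ => t * (‖y - p‖ ^ 2 / 2)) (nhdsWithin 0 (Set.Ioi 0))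
        (nhds 0) := by
      have : Filter.Tendsto (fun t : ℝ => t * (‖y - p‖ ^ 2 / 2)) (nhds 0)
          (nhds (0 * (‖y - p‖ ^ 2 / 2))) := (continuous_id.mul continuous_const).tendsto 0
      rw [zero_mul] at this
      exact this.mono_left nhdsWithin_le_nhds
    refine ge_of_tendsto h1 ?_
    filter_upwards [Ioc_mem_nhdsGT (zero_lt_one' ℝ)] with t ht using key t ht.1 ht.2
  rw [ha, hb, ← EReal.coe_add, EReal.coe_le_coe_iff]
  linarith

/-- If `x - p` is a subgradient of `f` at `p`, then `p` is a prox point of `x`. -/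
theorem isProxPoint_of_subgradient {f : E → EReal} {x p : E}
    (h : ∀ y, f p + (⟪y - p, x - p⟫_ℝ : EReal) ≤ f y) : IsProxPoint f x p := by
  intro y
  refine le_trans ?_ (add_le_add_left (h y) _)
  rw [add_assoc, ← EReal.coe_add]
  refine add_le_add_right (EReal.coe_le_coe_iff.2 ?_) _
  rw [norm_sub_sq_half_eq x p y]
  have := sq_nonneg ‖y - p‖
  linarith

variable [CompleteSpace E]

/-- Real-valued form of the subgradient inequality between two values of the prox operator. -/
theorem IsGammaZero.toReal_prox_add_inner_le {f : E → EReal} (hf : IsGammaZero f) (x y : E) :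
    (f (prox f x)).toReal + ⟪prox f y - prox f x, x - prox f x⟫_ℝ ≤ (f (prox f y)).toReal := by
  have hx := (hf.prox_eq_iff x _).1 rfl
  have hy := (hf.prox_eq_iff y _).1 rfl
  have h := hx.subgradient hf (prox f y)
  rw [← EReal.coe_toReal (hx.ne_top hf) (hf.ne_bot _),
    ← EReal.coe_toReal (hy.ne_top hf) (hf.ne_bot _), ← EReal.coe_add,
    EReal.coe_le_coe_iff] at h
  exact h

/-- The prox operator is nonexpansive. -/
theorem IsGammaZero.norm_prox_sub_le {f : E → EReal} (hf : IsGammaZero f) (x y : E) :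
    ‖prox f x - prox f y‖ ≤ ‖x - y‖ := by
  have h1 := hf.toReal_prox_add_inner_le x y
  have h2 := hf.toReal_prox_add_inner_le y x
  set p := prox f x
  set q := prox f y
  -- Adding the two subgradient inequalities gives firm nonexpansiveness, `‖p - q‖² ≤ ⟪p - q, x -
  -- y⟫`; Cauchy–Schwarz concludes.
  have h3 : ⟪q - p, x - p⟫_ℝ + ⟪p - q, y - q⟫_ℝ = ‖p - q‖ ^ 2 - ⟪p - q, x - y⟫_ℝ := by
    rw [← real_inner_self_eq_norm_sq, ← neg_sub p q, inner_neg_left, ← inner_sub_right,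
      neg_add_eq_sub, ← inner_sub_right]
    congr 1; abel
  have h4 := real_inner_le_norm (p - q) (x - y)
  by_contra! h
  have h5 : 0 ≤ ‖x - y‖ := norm_nonneg _
  nlinarith

end Prox

/-! ### Cyclic monotonicity and Rockafellar's theorem -/

section Rockafellar

variable {E : Type*} [NormedAddCommGroup E] [InnerProductSpace ℝ E]

/-- The value at `y` of the affine function attached to a chain `w 0, …, w n`. -/
noncomputable def chainAffine {ι : Type*} (a u : ι → E) (n : ℕ) (w : ℕ → ι) (y : E) : ℝ :=
  ∑ k ∈ Finset.range n, ⟪a (w (k + 1)) - a (w k), u (w k)⟫_ℝ + ⟪y - a (w n), u (w n)⟫_ℝ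

/-- Rockafellar's theorem: a cyclically monotone family of pairs is contained in the graph of
the subdifferential of a function in `Γ₀`. -/
theorem exists_isGammaZero_of_cyclicallyMonotone {ι : Type*} [Nonempty ι] (a u : ι → E)
    (hcyc : ∀ (n : ℕ) (w : ℕ → ι), w n = w 0 →
      ∑ k ∈ Finset.range n, ⟪a (w (k + 1)) - a (w k), u (w k)⟫_ℝ ≤ 0) :
    ∃ g : E → EReal, IsGammaZero g ∧
      ∀ i y, g (a i) + (⟪y - a i, u i⟫_ℝ : EReal) ≤ g y := by
  obtain ⟨i₀⟩ := ‹Nonempty ι›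
  -- Rockafellar's function: the supremum of the affine functions over all finite chains starting at
  -- a fixed `i₀`.
  set g : E → EReal := fun y =>
    ⨆ c : {c : ℕ × (ℕ → ι) // c.2 0 = i₀}, (chainAffine a u c.1.1 c.1.2 y : EReal) with hg
  have hle : ∀ (n : ℕ) (w : ℕ → ι), w 0 = i₀ → ∀ y, (chainAffine a u n w y : EReal) ≤ g y :=
    fun n w hw y => le_iSup (fun c : {c : ℕ × (ℕ → ι) // c.2 0 = i₀} =>
      (chainAffine a u c.1.1 c.1.2 y : EReal)) ⟨(n, w), hw⟩
  have hbot : ∀ y, g y ≠ ⊥ := fun y h => by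
    have := hle 0 (fun _ => i₀) rfl y
    rw [h] at this
    exact absurd this (not_le.2 (EReal.bot_lt_coe _))
  -- Appending `i` to a chain turns its affine value at `a i` into a plain chain sum.
  have hext : ∀ (n : ℕ) (w : ℕ → ι) (i : ι), ∃ w' : ℕ → ι, w' 0 = w 0 ∧ w' (n + 1) = i ∧
      ∑ k ∈ Finset.range (n + 1), ⟪a (w' (k + 1)) - a (w' k), u (w' k)⟫_ℝ =
        chainAffine a u n w (a i) := by
    intro n w i
    refine ⟨fun k => if k ≤ n then w k else i, by simp, by simp, ?_⟩
    rw [Finset.sum_range_succ, chainAffine]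
    congr 1
    · refine Finset.sum_congr rfl fun k hk => ?_
      have hk' := Finset.mem_range.1 hk
      simp only [if_pos (show k ≤ n by omega), if_pos (show k + 1 ≤ n by omega)]
    · simp
  -- Appending `i₀` closes the chain, so cyclic monotonicity applies; this is what makes `g` proper.
  have hzero : g (a i₀) ≤ 0 := by
    refine iSup_le fun ⟨⟨n, w⟩, hw⟩ => ?_
    obtain ⟨w', h0, h1, h2⟩ := hext n w i₀
    rw [← EReal.coe_zero, EReal.coe_le_coe_iff]
    simp only at hw ⊢
    rw [← h2]
    exact hcyc (n + 1) w' (by rw [h0, h1, hw])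
  refine ⟨g, ⟨hbot, ⟨a i₀, fun h => ?_⟩, ?_, ?_⟩, fun i y => ?_⟩
  · rw [h] at hzero
    exact absurd hzero (by simp)
  · refine lowerSemicontinuous_iSup fun c => Continuous.lowerSemicontinuous ?_
    refine continuous_coe_real_ereal.comp ?_
    unfold chainAffine
    fun_prop
  · have heq : {p : E × ℝ | g p.1 ≤ (p.2 : EReal)} =
        ⋂ c : {c : ℕ × (ℕ → ι) // c.2 0 = i₀}, {p : E × ℝ | chainAffine a u c.1.1 c.1.2 p.1 ≤ p.2} := by
      ext p
      simp only [hg, Set.mem_iInter, Set.mem_ofPred_eq, iSup_le_iff, EReal.coe_le_coe_iff]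
    rw [heq]
    refine convex_iInter fun c => ?_
    rintro ⟨x, s⟩ hx ⟨y, t⟩ hy α β hα hβ hαβ
    simp only [Set.mem_ofPred_eq, chainAffine, Prod.fst_add, Prod.smul_fst, Prod.snd_add,
      Prod.smul_snd, smul_eq_mul, inner_sub_left, inner_add_left, real_inner_smul_left] at hx hy ⊢
    obtain rfl : β = 1 - α := by linarith
    have h1 := mul_le_mul_of_nonneg_left hx hα
    have h2 := mul_le_mul_of_nonneg_left hy hβ
    linarith
  · have hsub : ∀ r : ℝ, g (a i) ≤ ((r - ⟪y - a i, u i⟫_ℝ : ℝ) : EReal) →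
        g (a i) + (⟪y - a i, u i⟫_ℝ : EReal) ≤ r := fun r hr => by
      refine (add_le_add_left hr _).trans ?_
      rw [← EReal.coe_add, sub_add_cancel]
    by_cases hy : g y = ⊤
    · rw [hy]; exact le_top
    rw [← EReal.coe_toReal hy (hbot y)]
    -- Each chain followed by `i` is again a competitor in the supremum defining `g y`, which gives
    -- the inequality chain by chain.
    refine hsub _ (iSup_le fun ⟨⟨n, w⟩, hw⟩ => ?_)
    obtain ⟨w', h0, h1, h2⟩ := hext n w i
    have h3 := hle (n + 1) w' (h0.trans hw) y
    rw [← EReal.coe_toReal hy (hbot y), EReal.coe_le_coe_iff, chainAffine, h2, h1] at h3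
    rw [EReal.coe_le_coe_iff]
    simp only
    linarith

end Rockafellar

/-! ### Measurability and square-integrable fields -/

section Measurability

variable {Ω : Type*} [MeasurableSpace Ω]

/-- In a separable inner product space, weakly measurable functions are strongly measurable. -/
theorem stronglyMeasurable_of_measurable_inner {G : Type*} [NormedAddCommGroup G]
    [InnerProductSpace ℝ G] [SeparableSpace G] {F : Ω → G}
    (h : ∀ v, Measurable fun ω => ⟪F ω, v⟫_ℝ) : StronglyMeasurable F := by
  borelize G
  have : SecondCountableTopology G := UniformSpace.secondCountable_of_separable G
  refine Measurable.stronglyMeasurable ?_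
  have hnorm : ∀ c, Measurable fun ω => ‖F ω - c‖ := by
    intro c
    refine measurable_of_Iic fun r => ?_
    rcases lt_or_ge r 0 with hr0 | hr0
    · convert MeasurableSet.empty
      ext ω
      simpa using hr0.trans_le (norm_nonneg _)
    -- A closed ball is a countable intersection of half-spaces with normals in a dense sequence.
    -- The case `r < 0` was split off because this fails in the zero space.
    have heq : (fun ω => ‖F ω - c‖) ⁻¹' Set.Iic r =
        ⋂ n, {ω | ⟪F ω, denseSeq G n⟫_ℝ - ⟪c, denseSeq G n⟫_ℝ ≤ r * ‖denseSeq G n‖} := by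
      ext ω
      simp only [Set.mem_preimage, Set.mem_Iic, Set.mem_iInter, Set.mem_ofPred_eq,
        ← inner_sub_left]
      refine ⟨fun hr n => (real_inner_le_norm _ _).trans (by gcongr), fun hr => ?_⟩
      have hall : ∀ v, ⟪F ω - c, v⟫_ℝ ≤ r * ‖v‖ := fun v =>
        (denseRange_denseSeq G).induction_on
          (p := fun v => ⟪F ω - c, v⟫_ℝ ≤ r * ‖v‖) v
          (isClosed_le (by fun_prop) (by fun_prop)) hr
      have h1 := hall (F ω - c)
      rw [real_inner_self_eq_norm_sq] at h1
      by_contra! h2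
      nlinarith [norm_nonneg (F ω - c)]
    rw [heq]
    exact MeasurableSet.iInter fun n =>
      measurableSet_le ((h _).sub measurable_const) measurable_const
  refine measurable_of_isOpen fun U hU => ?_
  -- By separability, `U` is a countable union of balls with centres in the dense sequence and
  -- rational radii.
  have heq : F ⁻¹' U = ⋃ c : {c : ℕ × ℚ // Metric.ball (denseSeq G c.1) c.2 ⊆ U},
      {ω | ‖F ω - denseSeq G c.1.1‖ < c.1.2} := by
    ext ω
    simp only [Set.mem_preimage, Set.mem_iUnion, Set.mem_ofPred_eq]
    constructor
    · intro hω
      obtain ⟨ε, hε, hsub⟩ := Metric.isOpen_iff.1 hU _ hω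
      obtain ⟨q, hq0, hq⟩ := exists_rat_btwn (half_pos hε)
      obtain ⟨n, hn⟩ := (denseRange_denseSeq G).exists_dist_lt (F ω) hq0
      refine ⟨⟨(n, q), fun x hx => hsub ?_⟩, by simpa [dist_eq_norm] using hn⟩
      have h1 := dist_triangle_right x (F ω) (denseSeq G n)
      rw [Metric.mem_ball] at hx ⊢
      linarith
    · rintro ⟨⟨⟨n, q⟩, hsub⟩, hc⟩
      exact hsub (by simpa [dist_eq_norm] using hc)
  rw [heq]
  exact MeasurableSet.iUnion fun c => measurableSet_lt (hnorm _) measurable_const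

/-- The operator norm of a family of operators on a separable space is measurable as soon as the
norms of all images are. -/
theorem measurable_opNorm_of_measurable_norm_apply {G : Type*} [NormedAddCommGroup G]
    [NormedSpace ℝ G] [SeparableSpace G] {H : Ω → Type*} [∀ ω, NormedAddCommGroup (H ω)]
    [∀ ω, NormedSpace ℝ (H ω)] {L : ∀ ω, G →L[ℝ] H ω}
    (h : ∀ v, Measurable fun ω => ‖L ω v‖) : Measurable fun ω => ‖L ω‖ := by
  refine measurable_of_Iic fun r => ?_
  rcases lt_or_ge r 0 with hr0 | hr0
  · convert MeasurableSet.empty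
    ext ω
    simpa using hr0.trans_le (norm_nonneg _)
  have heq : (fun ω => ‖L ω‖) ⁻¹' Set.Iic r =
      ⋂ n, {ω | ‖L ω (denseSeq G n)‖ ≤ r * ‖denseSeq G n‖} := by
    ext ω
    simp only [Set.mem_preimage, Set.mem_Iic, Set.mem_iInter, Set.mem_ofPred_eq]
    refine ⟨fun hr n => (L ω).le_of_opNorm_le hr _, fun hr => ?_⟩
    exact (L ω).opNorm_le_bound hr0 fun v =>
      (denseRange_denseSeq G).induction_on (p := fun v => ‖L ω v‖ ≤ r * ‖v‖) v
        (isClosed_le (by fun_prop) (by fun_prop)) hr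
  rw [heq]
  exact MeasurableSet.iInter fun n => measurableSet_le (h _) measurable_const

variable {H : Ω → Type*} [∀ ω, NormedAddCommGroup (H ω)] [∀ ω, InnerProductSpace ℝ (H ω)]
  {𝔊 : Submodule ℝ (∀ ω, H ω)}

/-- Polarization: `x`, `y` and `x + y` all lie in `𝔊`, so their norms are measurable. -/
theorem IsMeasurableVectorField.measurable_inner (h𝔊 : IsMeasurableVectorField 𝔊)
    {x y : ∀ ω, H ω} (hx : x ∈ 𝔊) (hy : y ∈ 𝔊) : Measurable fun ω => ⟪x ω, y ω⟫_ℝ := by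
  simp only [real_inner_eq_norm_add_mul_self_sub_norm_mul_self_sub_norm_mul_self_div_two]
  have h1 := h𝔊.measurable_norm _ (𝔊.add_mem hx hy)
  have h2 := h𝔊.measurable_norm _ hx
  have h3 := h𝔊.measurable_norm _ hy
  exact (((h1.mul h1).sub (h2.mul h2)).sub (h3.mul h3)).div_const 2

theorem IsMeasurableVectorField.mem_squareIntegrableFields_iff (h𝔊 : IsMeasurableVectorField 𝔊)
    {μ : Measure Ω} {x : ∀ ω, H ω} :
    x ∈ squareIntegrableFields μ 𝔊 ↔ x ∈ 𝔊 ∧ MemLp (fun ω => ‖x ω‖) 2 μ := by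
  refine and_congr_right fun hx => ?_
  rw [MemLp, and_iff_right (h𝔊.measurable_norm x hx).aestronglyMeasurable,
    eLpNorm_lt_top_iff_lintegral_rpow_enorm_lt_top (by norm_num) (by norm_num)]
  simp

theorem IsMeasurableVectorField.add_mem_squareIntegrableFields (h𝔊 : IsMeasurableVectorField 𝔊)
    {μ : Measure Ω} {x y : ∀ ω, H ω} (hx : x ∈ squareIntegrableFields μ 𝔊)
    (hy : y ∈ squareIntegrableFields μ 𝔊) : x + y ∈ squareIntegrableFields μ 𝔊 := by
  rw [h𝔊.mem_squareIntegrableFields_iff] at *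
  refine ⟨𝔊.add_mem hx.1 hy.1, (hx.2.add hy.2).of_le
    (h𝔊.measurable_norm _ (𝔊.add_mem hx.1 hy.1)).aestronglyMeasurable (.of_forall fun ω => ?_)⟩
  refine le_trans ?_ (le_abs_self _)
  simpa using norm_add_le (x ω) (y ω)

theorem IsMeasurableVectorField.sub_mem_squareIntegrableFields (h𝔊 : IsMeasurableVectorField 𝔊)
    {μ : Measure Ω} {x y : ∀ ω, H ω} (hx : x ∈ squareIntegrableFields μ 𝔊)
    (hy : y ∈ squareIntegrableFields μ 𝔊) : x - y ∈ squareIntegrableFields μ 𝔊 := by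
  rw [sub_eq_add_neg]
  refine h𝔊.add_mem_squareIntegrableFields hx ⟨𝔊.neg_mem hy.1, ?_⟩
  simpa using hy.2

theorem IsMeasurableVectorField.integrable_norm_sq (h𝔊 : IsMeasurableVectorField 𝔊)
    {μ : Measure Ω} {x : ∀ ω, H ω} (hx : x ∈ squareIntegrableFields μ 𝔊) :
    Integrable (fun ω => ‖x ω‖ ^ 2) μ :=
  (h𝔊.mem_squareIntegrableFields_iff.1 hx).2.integrable_sq

theorem IsMeasurableVectorField.integrable_inner (h𝔊 : IsMeasurableVectorField 𝔊)
    {μ : Measure Ω} {x y : ∀ ω, H ω} (hx : x ∈ squareIntegrableFields μ 𝔊)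
    (hy : y ∈ squareIntegrableFields μ 𝔊) : Integrable (fun ω => ⟪x ω, y ω⟫_ℝ) μ := by
  refine ((h𝔊.mem_squareIntegrableFields_iff.1 hx).2.integrable_mul
    (h𝔊.mem_squareIntegrableFields_iff.1 hy).2).mono
    (h𝔊.measurable_inner hx.1 hy.1).aestronglyMeasurable (.of_forall fun ω => ?_)
  simpa using abs_real_inner_le_norm (x ω) (y ω)

/-- The composition of the proximity operators with square integrable fields is square
integrable as soon as this holds for one of them. -/
theorem IsMeasurableVectorField.prox_mem_squareIntegrableFields [∀ ω, CompleteSpace (H ω)]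
    (h𝔊 : IsMeasurableVectorField 𝔊) {μ : Measure Ω} {f : ∀ ω, H ω → EReal}
    (hf : ∀ ω, IsGammaZero (f ω)) {x z : ∀ ω, H ω} (hx : x ∈ squareIntegrableFields μ 𝔊)
    (hz : z ∈ squareIntegrableFields μ 𝔊) (hfx : (fun ω => prox (f ω) (x ω)) ∈ 𝔊)
    (hfz : (fun ω => prox (f ω) (z ω)) ∈ squareIntegrableFields μ 𝔊) :
    (fun ω => prox (f ω) (x ω)) ∈ squareIntegrableFields μ 𝔊 := by
  -- Nonexpansiveness dominates this difference by `‖x - z‖`, which is in L².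
  have hd : (fun ω => prox (f ω) (x ω)) - (fun ω => prox (f ω) (z ω)) ∈
      squareIntegrableFields μ 𝔊 := by
    rw [h𝔊.mem_squareIntegrableFields_iff]
    have hm := 𝔊.sub_mem hfx hfz.1
    refine ⟨hm, (h𝔊.mem_squareIntegrableFields_iff.1
      (h𝔊.sub_mem_squareIntegrableFields hx hz)).2.mono
      (h𝔊.measurable_norm _ hm).aestronglyMeasurable (.of_forall fun ω => ?_)⟩
    simpa using (hf ω).norm_prox_sub_le (x ω) (z ω)
  have := h𝔊.add_mem_squareIntegrableFields hd hfz
  rwa [sub_add_cancel] at this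

end Measurability

/-! ### The averaged adjoint -/

section AdjointIntegral

variable {Ω : Type*} [MeasurableSpace Ω] {μ : Measure Ω}
  {H : Ω → Type*} [∀ ω, NormedAddCommGroup (H ω)] [∀ ω, InnerProductSpace ℝ (H ω)]
  {𝔊 : Submodule ℝ (∀ ω, H ω)}
  {G : Type*} [NormedAddCommGroup G] [InnerProductSpace ℝ G]
  [SeparableSpace G] {L : ∀ ω, G →L[ℝ] H ω}

theorem IsMeasurableVectorField.memLp_opNorm (h𝔊 : IsMeasurableVectorField 𝔊)
    (hC : ∀ z : G, (fun ω => L ω z) ∈ 𝔊) (hD : ∫⁻ ω, ‖L ω‖ₑ ^ 2 ∂μ < ⊤) :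
    MemLp (fun ω => ‖L ω‖) 2 μ := by
  refine ⟨(measurable_opNorm_of_measurable_norm_apply fun v =>
    h𝔊.measurable_norm _ (hC v)).aestronglyMeasurable, ?_⟩
  rw [eLpNorm_lt_top_iff_lintegral_rpow_enorm_lt_top (by norm_num) (by norm_num)]
  simpa using hD

theorem IsMeasurableVectorField.apply_mem_squareIntegrableFields
    (h𝔊 : IsMeasurableVectorField 𝔊)
    (hC : ∀ z : G, (fun ω => L ω z) ∈ 𝔊) (hD : ∫⁻ ω, ‖L ω‖ₑ ^ 2 ∂μ < ⊤) (z : G) :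
    (fun ω => L ω z) ∈ squareIntegrableFields μ 𝔊 := by
  rw [h𝔊.mem_squareIntegrableFields_iff]
  refine ⟨hC z, ((h𝔊.memLp_opNorm hC hD).mul_const ‖z‖).mono
    (h𝔊.measurable_norm _ (hC z)).aestronglyMeasurable (.of_forall fun ω => ?_)⟩
  simpa using (L ω).le_opNorm z

variable [CompleteSpace G] [∀ ω, CompleteSpace (H ω)]

/-- Weak measurability comes from `⟪L^* q, v⟫ = ⟪q, L v⟫` and is upgraded by separability of `G`;
the norm is dominated by `‖L‖ ‖q‖`, a product of two L² functions. -/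
theorem IsMeasurableVectorField.integrable_adjoint (h𝔊 : IsMeasurableVectorField 𝔊)
    (hC : ∀ z : G, (fun ω => L ω z) ∈ 𝔊) (hD : ∫⁻ ω, ‖L ω‖ₑ ^ 2 ∂μ < ⊤) {q : ∀ ω, H ω}
    (hq : q ∈ squareIntegrableFields μ 𝔊) :
    Integrable (fun ω => ContinuousLinearMap.adjoint (L ω) (q ω)) μ := by
  refine ((h𝔊.memLp_opNorm hC hD).integrable_mul
    (h𝔊.mem_squareIntegrableFields_iff.1 hq).2).mono
    (stronglyMeasurable_of_measurable_inner fun v => ?_).aestronglyMeasurable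
    (.of_forall fun ω => ?_)
  · simp only [ContinuousLinearMap.adjoint_inner_left]
    exact h𝔊.measurable_inner hq.1 (hC v)
  · have := (ContinuousLinearMap.adjoint (L ω)).le_opNorm (q ω)
    rw [LinearIsometryEquiv.norm_map] at this
    simpa using this

/-- Averaging `L_ω^* q(ω)` is thus adjoint to the map `v ↦ (L_ω v)_ω` from `G` to `𝔥`. -/
theorem IsMeasurableVectorField.inner_integral_adjoint (h𝔊 : IsMeasurableVectorField 𝔊)
    (hC : ∀ z : G, (fun ω => L ω z) ∈ 𝔊) (hD : ∫⁻ ω, ‖L ω‖ₑ ^ 2 ∂μ < ⊤) {q : ∀ ω, H ω}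
    (hq : q ∈ squareIntegrableFields μ 𝔊) (v : G) :
    ⟪∫ ω, ContinuousLinearMap.adjoint (L ω) (q ω) ∂μ, v⟫_ℝ = ∫ ω, ⟪q ω, L ω v⟫_ℝ ∂μ := by
  rw [real_inner_comm, ← integral_inner (h𝔊.integrable_adjoint hC hD hq)]
  refine integral_congr_ae (.of_forall fun ω => ?_)
  simp only [ContinuousLinearMap.adjoint_inner_right]
  rw [real_inner_comm]

/-- The averaged adjoint is a contraction from `𝔥` to `G` when `∫ ‖L ω‖² ≤ 1`. -/
theorem IsMeasurableVectorField.norm_integral_adjoint_sq_le (h𝔊 : IsMeasurableVectorField 𝔊)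
    (hC : ∀ z : G, (fun ω => L ω z) ∈ 𝔊) (hD : ∫⁻ ω, ‖L ω‖ₑ ^ 2 ∂μ ≤ 1) {q : ∀ ω, H ω}
    (hq : q ∈ squareIntegrableFields μ 𝔊) :
    ‖∫ ω, ContinuousLinearMap.adjoint (L ω) (q ω) ∂μ‖ ^ 2 ≤ ∫ ω, ‖q ω‖ ^ 2 ∂μ := by
  have hD' := hD.trans_lt ENNReal.one_lt_top
  set d := ∫ ω, ContinuousLinearMap.adjoint (L ω) (q ω) ∂μ with hd
  have hL2 := (h𝔊.memLp_opNorm hC hD').integrable_sq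
  have hq2 := h𝔊.integrable_norm_sq hq
  have hL1 : ∫ ω, ‖L ω‖ ^ 2 ∂μ ≤ 1 := by
    rw [integral_eq_lintegral_of_nonneg_ae (.of_forall fun ω => sq_nonneg _)
      hL2.aestronglyMeasurable]
    refine ENNReal.toReal_le_of_le_ofReal zero_le_one ?_
    simpa [ENNReal.ofReal_pow, ofReal_norm] using hD
  -- Testing `d` against itself and using `⟪q, L d⟫ ≤ ½‖L‖²‖d‖² + ½‖q‖²`; by (D) the first term
  -- integrates to at most `½‖d‖²` and is absorbed on the left.
  have h1 : ‖d‖ ^ 2 ≤ ∫ ω, (‖L ω‖ ^ 2 * (‖d‖ ^ 2 / 2) + ‖q ω‖ ^ 2 / 2) ∂μ := by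
    have h0 : ‖d‖ ^ 2 = ∫ ω, ⟪q ω, L ω d⟫_ℝ ∂μ := by
      rw [← h𝔊.inner_integral_adjoint hC hD' hq, ← hd, real_inner_self_eq_norm_sq]
    refine h0.le.trans <| integral_mono (h𝔊.integrable_inner hq
      (h𝔊.apply_mem_squareIntegrableFields hC hD' d))
      ((hL2.mul_const _).add (hq2.div_const _)) fun ω => ?_
    have h2 := real_inner_le_norm (q ω) (L ω d)
    have h3 := (L ω).le_opNorm d
    have h4 := two_mul_le_add_sq ‖q ω‖ ‖L ω d‖
    have h5 : ‖L ω d‖ ^ 2 ≤ ‖L ω‖ ^ 2 * ‖d‖ ^ 2 := by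
      rw [← mul_pow]; gcongr
    simp only
    linarith
  rw [integral_add (hL2.mul_const _) (hq2.div_const _), integral_mul_const,
    integral_div] at h1
  have h2 := mul_le_mul_of_nonneg_right hL1 (by positivity : 0 ≤ ‖d‖ ^ 2 / 2)
  linarith

end AdjointIntegral

/-! ### Cyclic sums and the main theorem -/

/-- Telescoping of `⟪b - a, a⟫ = (‖b‖² - ‖a‖² - ‖b - a‖²) / 2` along a closed chain. -/
theorem sum_inner_sub_eq_of_closed {E : Type*} [NormedAddCommGroup E] [InnerProductSpace ℝ E]
    (p : ℕ → E) {n : ℕ} (hn : p n = p 0) :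
    ∑ k ∈ Finset.range n, ⟪p (k + 1) - p k, p k⟫_ℝ =
      -∑ k ∈ Finset.range n, ‖p (k + 1) - p k‖ ^ 2 / 2 := by
  have h : ∀ k, ⟪p (k + 1) - p k, p k⟫_ℝ =
      (‖p (k + 1)‖ ^ 2 / 2 - ‖p k‖ ^ 2 / 2) - ‖p (k + 1) - p k‖ ^ 2 / 2 := fun k => by
    rw [norm_sub_sq_real, inner_sub_left, real_inner_self_eq_norm_sq]; ring
  simp only [h]
  rw [Finset.sum_sub_distrib, Finset.sum_range_sub (fun k => ‖p k‖ ^ 2 / 2), hn, sub_self,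
    zero_sub]

/-- Cyclic sums of a proximity operator. -/
theorem IsGammaZero.sum_inner_prox_le_of_closed {E : Type*} [NormedAddCommGroup E]
    [InnerProductSpace ℝ E] [CompleteSpace E] {f : E → EReal} (hf : IsGammaZero f)
    (x : ℕ → E) {n : ℕ} (hn : x n = x 0) :
    ∑ k ∈ Finset.range n, ⟪prox f (x (k + 1)) - prox f (x k), x k⟫_ℝ ≤
      -∑ k ∈ Finset.range n, ‖prox f (x (k + 1)) - prox f (x k)‖ ^ 2 / 2 := by
  -- The right side is rewritten as `Σ ⟪Δprox, prox f (x k)⟫`, so that the difference pairs each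
  -- increment with the subgradient `x k - prox f (x k)`.
  rw [← sum_inner_sub_eq_of_closed (fun k => prox f (x k)) (by rw [hn]), ← sub_nonpos,
    ← Finset.sum_sub_distrib]
  calc _ ≤ ∑ k ∈ Finset.range n, ((f (prox f (x (k + 1)))).toReal - (f (prox f (x k))).toReal) := by
        refine Finset.sum_le_sum fun k _ => ?_
        rw [← inner_sub_right]
        linarith [hf.toReal_prox_add_inner_le (x k) (x (k + 1))]
    _ = 0 := by rw [Finset.sum_range_sub (fun k => (f (prox f (x k))).toReal), hn, sub_self]

theorem theoremt {Ω : Type*} [MeasurableSpace Ω] (μ : Measure Ω) [μ.IsComplete] [SigmaFinite μ]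
    {H : Ω → Type*} [∀ ω, NormedAddCommGroup (H ω)] [∀ ω, InnerProductSpace ℝ (H ω)]
    [∀ ω, CompleteSpace (H ω)]
    (𝔊 : Submodule ℝ (∀ ω, H ω)) (h𝔊 : IsMeasurableVectorField 𝔊)
    {G : Type*} [NormedAddCommGroup G] [InnerProductSpace ℝ G] [CompleteSpace G]
    [SeparableSpace G]
    (f : ∀ ω, H ω → EReal) (hf : ∀ ω, IsGammaZero (f ω))
    (L : ∀ ω, G →L[ℝ] H ω)
    (hA : ∀ x ∈ squareIntegrableFields μ 𝔊, (fun ω => prox (f ω) (x ω)) ∈ 𝔊)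
    (hB : ∃ z ∈ squareIntegrableFields μ 𝔊,
      (fun ω => prox (f ω) (z ω)) ∈ squareIntegrableFields μ 𝔊)
    (hC : ∀ z : G, (fun ω => L ω z) ∈ 𝔊)
    (hD : ∫⁻ ω, ‖L ω‖ₑ ^ 2 ∂μ ≤ 1) :
    (∀ z : G, Integrable
      (fun ω => ContinuousLinearMap.adjoint (L ω) (prox (f ω) (L ω z))) μ) ∧
    ∃ g : G → EReal, IsGammaZero g ∧
      ∀ z : G, prox g z =
        ∫ ω, ContinuousLinearMap.adjoint (L ω) (prox (f ω) (L ω z)) ∂μ := by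
  have hD' := hD.trans_lt ENNReal.one_lt_top
  have hLz := fun z => h𝔊.apply_mem_squareIntegrableFields hC hD' z
  obtain ⟨z₀, hz₀, hfz₀⟩ := hB
  have hP : ∀ z, (fun ω => prox (f ω) (L ω z)) ∈ squareIntegrableFields μ 𝔊 := fun z =>
    h𝔊.prox_mem_squareIntegrableFields hf (hLz z) hz₀ (hA _ (hLz z)) hfz₀
  have hint := fun z => h𝔊.integrable_adjoint hC hD' (hP z)
  refine ⟨hint, ?_⟩
  set T : G → G := fun z => ∫ ω, ContinuousLinearMap.adjoint (L ω) (prox (f ω) (L ω z)) ∂μ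
    with hT
  have hQ : ∀ z z', (fun ω => prox (f ω) (L ω z) - prox (f ω) (L ω z')) ∈
      squareIntegrableFields μ 𝔊 := fun z z' =>
    h𝔊.sub_mem_squareIntegrableFields (hP z) (hP z')
  have hTsub : ∀ z z', T z - T z' = ∫ ω, ContinuousLinearMap.adjoint (L ω)
      (prox (f ω) (L ω z) - prox (f ω) (L ω z')) ∂μ := fun z z' => by
    rw [hT, ← integral_sub (hint z) (hint z')]
    simp only [map_sub]
  have hcyc : ∀ (n : ℕ) (w : ℕ → G), w n = w 0 →
      ∑ k ∈ Finset.range n, ⟪T (w (k + 1)) - T (w k), w k - T (w k)⟫_ℝ ≤ 0 := by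
    intro n w hw
    simp only [inner_sub_right (T (w _) - T (w _))]
    rw [Finset.sum_sub_distrib, sum_inner_sub_eq_of_closed (fun k => T (w k)) (by rw [hw])]
    -- The pointwise cyclic estimate for `f_ω` along the chain `L_ω w_k`, integrated over `Ω`.
    have h1 : ∑ k ∈ Finset.range n, ⟪T (w (k + 1)) - T (w k), w k⟫_ℝ ≤
        -∑ k ∈ Finset.range n,
          (∫ ω, ‖prox (f ω) (L ω (w (k + 1))) - prox (f ω) (L ω (w k))‖ ^ 2 ∂μ) / 2 := by
      simp only [hTsub, h𝔊.inner_integral_adjoint hC hD' (hQ _ _), ← integral_div]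
      have hi := fun k => h𝔊.integrable_inner (hQ (w (k + 1)) (w k)) (hLz (w k))
      have hi' := fun k => (h𝔊.integrable_norm_sq (hQ (w (k + 1)) (w k))).div_const 2
      rw [← integral_finsetSum _ fun k _ => hi k, ← integral_finsetSum _ fun k _ => hi' k,
        ← integral_neg]
      exact integral_mono (integrable_finsetSum _ fun k _ => hi k)
        (integrable_finsetSum _ fun k _ => hi' k).neg fun ω =>
          (hf ω).sum_inner_prox_le_of_closed (fun k => L ω (w k)) (by simp only [hw])
    -- Only here is the bound 1 in (D) needed; elsewhere finiteness of the integral suffices.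
    have h2 : ∑ k ∈ Finset.range n, ‖T (w (k + 1)) - T (w k)‖ ^ 2 / 2 ≤
        ∑ k ∈ Finset.range n,
          (∫ ω, ‖prox (f ω) (L ω (w (k + 1))) - prox (f ω) (L ω (w k))‖ ^ 2 ∂μ) / 2 := by
      refine Finset.sum_le_sum fun k _ => ?_
      rw [hTsub]
      have := h𝔊.norm_integral_adjoint_sq_le hC hD (hQ (w (k + 1)) (w k))
      linarith
    linarith
  obtain ⟨g, hg, hsub⟩ := exists_isGammaZero_of_cyclicallyMonotone T (fun z => z - T z) hcyc
  exact ⟨g, hg, fun z => (hg.prox_eq_iff z _).2 (isProxPoint_of_subgradient (hsub z))⟩
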